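/- Let $\mathcal X$ and $\mathcal Y$ be (real or complex) Hilbert spaces, let $A$ with domain $\mathscr D(A)\subset\mathcal X$ generate a strongly continuous semigroup $e^{At}$ on $\mathcal X$ and be skew-adjoint, that is, $\mathscr D(A^*)=\mathscr D(A)$ and $A+A^*=0$. Let $C:\mathcal X\to\mathcal Y$ be bounded and linear, let $T>0$ and $\kappa>0$, and assume exact observability at time $T$: there is $\delta>0$ such that $\int_0^T\|Ce^{At}x\|^2\,dt\ge\delta\|x\|^2$ for all $x\in\mathcal X$. Given $f\in L^1(0,T;\mathcal X)$ and $y\in L^2(0,T;\mathcal Y)$, the back and forth nudging (BFN) method with constant colocated gain $\kappa$ and initial guess $x_1\in\mathcal X$ consists of the functions $z_j^{+},z_j^-:[0,T]\to\mathcal X$, $j=1,2,\dots$, solving $$\dot z_j^+(t)=Az_j^+(t)+f(t)+\kappa C^*\big(y(t)-Cz_j^+(t)\big),\qquad z_1^+(0)=x_1,\quad z_j^+(0)=z_{j-1}^-(T)\ (j\ge2),$$ $$\dot z_j^-(t)=-Az_j^-(t)-f(T-t)+\kappa C^*\big(y(T-t)-Cz_j^-(t)\big),\qquad z_j^-(0)=z_j^+(T).$$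 All differential equations are understood in the mild sense: $z$ is a solution of $\dot z=Bz+g$ on $[0,T]$ if $z$ is continuous, $g$ is integrable and, for all $t\in[0,T]$, $\int_0^tz(s)\,ds\in\mathscr D(B)$ and $z(t)=z(0)+B\int_0^tz(s)\,ds+\int_0^tg(s)\,ds$. Then there are constants $M\ge0$ and $\gamma\in[0,1)$, not depending on $f$, $y$ and $x_1$, such that for all $f\in L^1(0,T;\mathcal X)$ and $y\in L^2(0,T;\mathcal Y)$ the following hold. 1. For every $x\in\mathcal X$ the closed-loop system $\dot z[x]=Az[x]+f+\kappa C^*(y-Cz[x])$, $z[x](0)=x$, has a unique solution on $[0,T]$. 2. The cost function $J(x)=\frac12\int_0^T\|y(s)-Cz[x](s)\|^2\,ds$ has a unique minimizer $x^o\in\mathcal X$. 3. For every $x_1\in\mathcal X$ the BFN method with initial guess $x_1$ is well defined, and its initial state estimates converge exponentially to $x^o$: $\|z_j^-(T)-x^o\|\le M\gamma^j\|x_1-x^o\|$ for all $j\ge1$. -/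

import Mathlib

open MeasureTheory Set Filter Topology

namespace BFN

section Operators

variable {𝕜 X : Type*} [RCLike 𝕜] [NormedAddCommGroup X] [InnerProductSpace 𝕜 X]

/-- `S` is a strongly continuous semigroup of bounded operators on `X`. Only the values `S t` with
`0 ≤ t` carry meaning. -/
structure IsC0Semigroup (S : ℝ → X →L[𝕜] X) : Prop where
  map_zero : S 0 = ContinuousLinearMap.id 𝕜 X
  map_add : ∀ s t : ℝ, 0 ≤ s → 0 ≤ t → S (s + t) = (S s).comp (S t)
  continuousOn : ∀ x : X, ContinuousOn (fun t : ℝ => S t x) (Ici 0)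

/-- The (in general unbounded) operator `A` is the infinitesimal generator of `S`: the domain of `A`
consists of those `x` for which `(S h x - x) / h` converges as `h ↓ 0`, and the limit is `A x`. -/
def IsGenerator (A : X →ₗ.[𝕜] X) (S : ℝ → X →L[𝕜] X) : Prop :=
  ∀ x v : X, (x, v) ∈ A.graph ↔
    Tendsto (fun h : ℝ => ((h : 𝕜)⁻¹) • (S h x - x)) (𝓝[>] 0) (𝓝 v)

/-- `A` is skew-adjoint: densely defined, with `D(A*) = D(A)` and `A + A* = 0`. (Equality of
partially defined operators includes equality of the domains.) -/
def IsSkewAdjoint [CompleteSpace X] (A : X →ₗ.[𝕜] X) : Prop :=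
  Dense (A.domain : Set X) ∧ A.adjoint = -A

/-- `z` is a mild solution on `[0, T]` of `ż(t) = B z(t) + g(t)`, in the integrated sense: `z` is
continuous, `g` is integrable, and for every `t ∈ [0, T]` the integral `∫₀ᵗ z` lies in `D(B)` and
`z(t) - z(0) - ∫₀ᵗ g = B (∫₀ᵗ z)`. -/
structure IsMildSolution [NormedSpace ℝ X] (B : X →ₗ.[𝕜] X) (g : ℝ → X) (T : ℝ) (z : ℝ → X) :
    Prop where
  continuousOn : ContinuousOn z (Icc 0 T)
  integrable : IntervalIntegrable g volume 0 T
  mem_graph : ∀ t ∈ Icc (0 : ℝ) T,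
    (∫ s in (0 : ℝ)..t, z s, z t - z 0 - ∫ s in (0 : ℝ)..t, g s) ∈ B.graph

end Operators

section Observers

variable {𝕜 X Y : Type*} [RCLike 𝕜]
  [NormedAddCommGroup X] [InnerProductSpace 𝕜 X] [CompleteSpace X] [NormedSpace ℝ X]
  [NormedAddCommGroup Y] [InnerProductSpace 𝕜 Y] [CompleteSpace Y]

/-- `ż = A z + f + κ C* (y - C z)` on `[0, T]`. -/
def IsForwardSolution (A : X →ₗ.[𝕜] X) (C : X →L[𝕜] Y) (κ T : ℝ) (f : ℝ → X) (y : ℝ → Y)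
    (z : ℝ → X) : Prop :=
  IsMildSolution A (fun t => f t + κ • C.adjoint (y t - C (z t))) T z

/-- `ż(t) = -A z(t) - f(T - t) + κ C* (y(T - t) - C z(t))` on `[0, T]`. -/
def IsBackwardSolution (A : X →ₗ.[𝕜] X) (C : X →L[𝕜] Y) (κ T : ℝ) (f : ℝ → X) (y : ℝ → Y)
    (z : ℝ → X) : Prop :=
  IsMildSolution (-A) (fun t => -f (T - t) + κ • C.adjoint (y (T - t) - C (z t))) T z

/-- `zp j`, `zm j` (for `j = 1, 2, …`) are the forward and backward observers of the back and forth
nudging method with colocated feedback and gains `κ j`. The values at `j = 0` are not used. -/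
structure IsBFNRun (A : X →ₗ.[𝕜] X) (C : X →L[𝕜] Y) (κ : ℕ → ℝ) (T : ℝ) (f : ℝ → X) (y : ℝ → Y)
    (zp zm : ℕ → ℝ → X) : Prop where
  forward : ∀ j, 1 ≤ j → IsForwardSolution A C (κ j) T f y (zp j)
  backward : ∀ j, 1 ≤ j → IsBackwardSolution A C (κ j) T f y (zm j)
  backward_init : ∀ j, 1 ≤ j → zm j 0 = zp j T
  forward_init : ∀ j, 1 ≤ j → zp (j + 1) 0 = zm j T

end Observers

section Output

variable {𝕜 X Y : Type*} [RCLike 𝕜]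
  [NormedAddCommGroup X] [InnerProductSpace 𝕜 X]
  [NormedAddCommGroup Y] [InnerProductSpace 𝕜 Y]

/-- Exact observability at time `T`: `∫₀ᵀ ‖C S(t) x‖² dt ≥ δ ‖x‖²` for some `δ > 0` and all `x`. -/
def IsExactlyObservable (S : ℝ → X →L[𝕜] X) (C : X →L[𝕜] Y) (T : ℝ) : Prop :=
  ∃ δ : ℝ, 0 < δ ∧ ∀ x : X, δ * ‖x‖ ^ 2 ≤ ∫ t in (0 : ℝ)..T, ‖C (S t x)‖ ^ 2

/-- The output discrepancy `½ ∫₀ᵀ ‖y(s) - C z(s)‖² ds` of a trajectory `z`. -/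
noncomputable def outputCost (C : X →L[𝕜] Y) (T : ℝ) (y : ℝ → Y) (z : ℝ → X) : ℝ :=
  (1 / 2) * ∫ s in (0 : ℝ)..T, ‖y s - C (z s)‖ ^ 2

end Output

end BFN

/-! One round trip of the method, `x ↦ z_j^-(T)` with `z_j^+(0) = x`, is a strict contraction whose
fixed point satisfies the normal equations of `J`.

Since `A` is skew-adjoint, the difference `φ` of two forward runs satisfies `‖φ(T)‖² - ‖φ(0)‖² = -2κ
∫ ‖Cφ‖²` (`IsUnitaryFlow.norm_sq_sub_norm_sq`). Observability of the free flow passes to the closed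
loop (`IsUnitaryFlow.exists_observability_feedback`), so the integral is at least `δ‖φ(0)‖²`. The
same balance, read in reversed time, shows that the backward leg does not expand. Hence the
contraction factor `√(1 - 2κδ)` and, by Banach, a fixed point `xo`.

At `xo` let `z` be the forward run and `w` the backward one. Then `e(t) = w(T-t) - z(t)` vanishes at
both ends and solves `ė = Ae + κC*Ce - 2κC*(y - Cz)`. Its homogeneous part is adjoint to the error
equation `φ̇ = Aφ - κC*Cφ`; pairing the two leaves `∫ ⟪y - Cz, Cφ⟫ = 0`
(`IsUnitaryFlow.integral_inner_eq_zero`). By Pythagoras `J(x) - J(xo) = ½ ∫ ‖C(z[x] - z[xo])‖² ≥ ½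
δ‖x - xo‖²`.

Mild solutions need not be differentiable. The inverse flow turns them into primitives of integrable
functions, for which a product rule holds; all energy identities come from
`IsUnitaryFlow.inner_sub_inner`. -/

namespace BFN

/-! ### Product rule for primitives of integrable functions -/

section Primitives

variable {𝕜 X : Type*} [RCLike 𝕜] [NormedAddCommGroup X] [InnerProductSpace 𝕜 X]

local notation "⟪" x ", " y "⟫" => inner 𝕜 x y

theorem absolutelyContinuousOnInterval_of_dist_le {E : Type*} [PseudoMetricSpace E]
    {F : ℝ → E} {G : ℝ → ℝ} {a b : ℝ} (hG : AbsolutelyContinuousOnInterval G a b)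
    (h : ∀ x ∈ uIcc a b, ∀ y ∈ uIcc a b, dist (F x) (F y) ≤ dist (G x) (G y)) :
    AbsolutelyContinuousOnInterval F a b := by
  rw [absolutelyContinuousOnInterval_iff] at hG ⊢
  intro ε hε
  obtain ⟨δ, hδ, H⟩ := hG ε hε
  refine ⟨δ, hδ, fun E hE hlt => lt_of_le_of_lt ?_ (H E hE hlt)⟩
  refine Finset.sum_le_sum fun i hi => ?_
  have := hE.1 i hi
  exact h _ this.1 _ this.2

theorem integral_primitive_sub {E : Type*} [NormedAddCommGroup E] [NormedSpace ℝ E] {γ : ℝ → E}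
    {T x y : ℝ} (hγ : IntervalIntegrable γ volume 0 T) (hx : x ∈ uIcc 0 T) (hy : y ∈ uIcc 0 T) :
    (∫ s in (0 : ℝ)..y, γ s) - (∫ s in (0 : ℝ)..x, γ s) = ∫ s in x..y, γ s :=
  intervalIntegral.integral_interval_sub_left
    (hγ.mono_set (uIcc_subset_uIcc left_mem_uIcc hy))
    (hγ.mono_set (uIcc_subset_uIcc left_mem_uIcc hx))

theorem intervalIntegrable_inner {u v : ℝ → X} {a b : ℝ}
    (hu : IntervalIntegrable u volume a b) (hv : ContinuousOn v (uIcc a b)) :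
    IntervalIntegrable (fun s => ⟪u s, v s⟫) volume a b := by
  obtain ⟨M, hM⟩ := isCompact_uIcc.exists_bound_of_continuousOn hv
  have hvm : AEStronglyMeasurable v (volume.restrict (uIoc a b)) :=
    (hv.mono uIoc_subset_uIcc).aestronglyMeasurable measurableSet_uIoc
  rw [intervalIntegrable_iff] at hu ⊢
  refine (hu.norm.mul_const M).mono (hu.aestronglyMeasurable.inner hvm) ?_
  filter_upwards [ae_restrict_mem measurableSet_uIoc] with s hs
  have h1 := hM s (uIoc_subset_uIcc hs)
  calc ‖⟪u s, v s⟫‖ ≤ ‖u s‖ * ‖v s‖ := norm_inner_le_norm _ _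
    _ ≤ ‖u s‖ * M := by gcongr
    _ ≤ ‖‖u s‖ * M‖ := le_abs_self _

theorem intervalIntegrable_inner' {u v : ℝ → X} {a b : ℝ}
    (hu : ContinuousOn u (uIcc a b)) (hv : IntervalIntegrable v volume a b) :
    IntervalIntegrable (fun s => ⟪u s, v s⟫) volume a b := by
  have := intervalIntegrable_inner (𝕜 := 𝕜) hv hu
  rw [intervalIntegrable_iff] at this ⊢
  have h := (RCLike.conjCLE (K := 𝕜)).toContinuousLinearMap.integrable_comp this
  refine h.congr (Eventually.of_forall fun s => ?_)
  simp [inner_conj_symm]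

variable [NormedSpace ℝ X]

theorem inner_intervalIntegral [CompleteSpace X] {f : ℝ → X} {a b : ℝ} (x : X)
    (hf : IntervalIntegrable f volume a b) :
    ⟪x, ∫ s in a..b, f s⟫ = ∫ s in a..b, ⟪x, f s⟫ :=
  ((innerSL 𝕜 x).intervalIntegral_comp_comm hf).symm

theorem intervalIntegral_inner [CompleteSpace X] {f : ℝ → X} {a b : ℝ} (x : X)
    (hf : IntervalIntegrable f volume a b) :
    ⟪∫ s in a..b, f s, x⟫ = ∫ s in a..b, ⟪f s, x⟫ := by
  rw [← inner_conj_symm, inner_intervalIntegral x hf, ← intervalIntegral.intervalIntegral_conj]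
  simp [inner_conj_symm]



/-- The product rule for primitives of integrable functions. -/
theorem inner_primitive_sub [CompleteSpace X] {α β a b : ℝ → X} {T : ℝ}
    (hα : IntervalIntegrable α volume 0 T) (hβ : IntervalIntegrable β volume 0 T)
    (ha : ∀ t ∈ uIcc 0 T, a t = a 0 + ∫ s in (0 : ℝ)..t, α s)
    (hb : ∀ t ∈ uIcc 0 T, b t = b 0 + ∫ s in (0 : ℝ)..t, β s) :
    ⟪a T, b T⟫ - ⟪a 0, b 0⟫ = ∫ s in (0 : ℝ)..T, (⟪α s, b s⟫ + ⟪a s, β s⟫) := by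
  have h0 : (0 : ℝ) ∈ uIcc 0 T := left_mem_uIcc
  have hT : T ∈ uIcc 0 T := right_mem_uIcc
  set a' : ℝ → X := fun t => a 0 + ∫ s in (0 : ℝ)..t, α s
  set b' : ℝ → X := fun t => b 0 + ∫ s in (0 : ℝ)..t, β s
  have hcont : ∀ γ : ℝ → X, IntervalIntegrable γ volume 0 T →
      ContinuousOn (fun t => ∫ s in (0 : ℝ)..t, γ s) (uIcc 0 T) := fun γ hγ =>
    intervalIntegral.continuousOn_primitive_interval' hγ h0
  have hac : ContinuousOn a' (uIcc 0 T) := continuousOn_const.add (hcont α hα)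
  have hbc : ContinuousOn b' (uIcc 0 T) := continuousOn_const.add (hcont β hβ)
  have hγ : IntervalIntegrable (fun s => ⟪α s, b' s⟫ + ⟪a' s, β s⟫) volume 0 T :=
    (intervalIntegrable_inner hα hbc).add (intervalIntegrable_inner' hac hβ)
  obtain ⟨M, hM⟩ := isCompact_uIcc.exists_bound_of_continuousOn hac
  obtain ⟨N, hN⟩ := isCompact_uIcc.exists_bound_of_continuousOn hbc
  -- The increments of `F` are dominated by those of the primitive of `m`, so `F` is absolutely
  -- continuous; `N` and `M` bound the factors that are not differenced.
  set m : ℝ → ℝ := fun s => ‖α s‖ * N + M * ‖β s‖ + ‖⟪α s, b' s⟫ + ⟪a' s, β s⟫‖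
  have hm : IntervalIntegrable m volume 0 T :=
    ((hα.norm.mul_const N).add (hβ.norm.const_mul M)).add hγ.norm
  set F : ℝ → 𝕜 := fun t => ⟪a' t, b' t⟫ - ∫ s in (0 : ℝ)..t, (⟪α s, b' s⟫ + ⟪a' s, β s⟫)
  have hF : AbsolutelyContinuousOnInterval F 0 T := by
    refine absolutelyContinuousOnInterval_of_dist_le
      (hm.absolutelyContinuousOnInterval_intervalIntegral h0) ?_
    have hle : ∀ x ∈ uIcc 0 T, ∀ y ∈ uIcc 0 T, x ≤ y →
        dist (F y) (F x) ≤ (∫ s in (0 : ℝ)..y, m s) - ∫ s in (0 : ℝ)..x, m s := by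
      intro x hx y hy hxy
      have hsub : uIcc x y ⊆ uIcc 0 T := uIcc_subset_uIcc hx hy
      have ea : a' y - a' x = ∫ s in x..y, α s := by
        rw [← integral_primitive_sub hα hx hy]; simp only [a']; abel
      have eb : b' y - b' x = ∫ s in x..y, β s := by
        rw [← integral_primitive_sub hβ hx hy]; simp only [b']; abel
      have eF : F y - F x = ⟪a' y, b' y - b' x⟫ + ⟪a' y - a' x, b' x⟫ -
          ∫ s in x..y, (⟪α s, b' s⟫ + ⟪a' s, β s⟫) := by
        rw [← integral_primitive_sub hγ hx hy, inner_sub_right, inner_sub_left]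
        simp only [F]; ring
      have n1 := intervalIntegral.norm_integral_le_integral_norm (f := α) (μ := volume) hxy
      have n2 := intervalIntegral.norm_integral_le_integral_norm (f := β) (μ := volume) hxy
      have n3 := intervalIntegral.norm_integral_le_integral_norm
        (f := fun s => ⟪α s, b' s⟫ + ⟪a' s, β s⟫) (μ := volume) hxy
      have em : ∫ s in x..y, m s = (∫ s in x..y, ‖α s‖) * N + M * (∫ s in x..y, ‖β s‖) +
          ∫ s in x..y, ‖⟪α s, b' s⟫ + ⟪a' s, β s⟫‖ := by
        simp only [m]
        rw [intervalIntegral.integral_add, intervalIntegral.integral_add,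
          intervalIntegral.integral_mul_const, intervalIntegral.integral_const_mul]
        exacts [(hα.mono_set hsub).norm.mul_const N, (hβ.mono_set hsub).norm.const_mul M,
          ((hα.mono_set hsub).norm.mul_const N).add ((hβ.mono_set hsub).norm.const_mul M),
          (hγ.mono_set hsub).norm]
      rw [integral_primitive_sub hm hx hy, em, dist_eq_norm, eF]
      refine (norm_sub_le _ _).trans (add_le_add ((norm_add_le _ _).trans ?_) n3)
      rw [add_comm]
      refine add_le_add ((norm_inner_le_norm _ _).trans ?_) ((norm_inner_le_norm _ _).trans ?_)
      · exact mul_le_mul (ea ▸ n1) (hN x hx) (norm_nonneg _) ((norm_nonneg _).trans n1)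
      · exact mul_le_mul (hM y hy) (eb ▸ n2) (norm_nonneg _) ((norm_nonneg _).trans (hM y hy))
    intro x hx y hy
    rcases le_total x y with h | h
    · rw [dist_comm, dist_comm (∫ s in (0 : ℝ)..x, m s)]
      exact (hle x hx y hy h).trans (le_abs_self _)
    · exact (hle y hy x hx h).trans (le_abs_self _)
  -- Lebesgue differentiation: the derivative of `F` vanishes almost everywhere, so absolute
  -- continuity makes `F` constant.
  have hd : ∀ᵐ x, x ∈ uIcc 0 T → HasDerivAt F 0 x := by
    filter_upwards [hα.ae_hasDerivAt_integral, hβ.ae_hasDerivAt_integral,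
      hγ.ae_hasDerivAt_integral] with x h1 h2 h3 hx
    have e1 : HasDerivAt a' (α x) x := (h1 hx 0 h0).const_add _
    have e2 : HasDerivAt b' (β x) x := (h2 hx 0 h0).const_add _
    convert! (e1.inner 𝕜 e2).sub (h3 hx 0 h0) using 1
    ring
  obtain ⟨c, hc⟩ := hF.const_of_ae_hasDerivAt_zero hd
  have e := (hc T hT).trans (hc 0 h0).symm
  have e' : ∫ s in (0 : ℝ)..T, (⟪α s, b s⟫ + ⟪a s, β s⟫) =
      ∫ s in (0 : ℝ)..T, (⟪α s, b' s⟫ + ⟪a' s, β s⟫) := by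
    refine intervalIntegral.integral_congr fun s hs => ?_
    simp only [a', b', ← ha s hs, ← hb s hs]
  rw [e', ha T hT, hb T hT]
  simp only [F, a', b', intervalIntegral.integral_same, add_zero, sub_zero] at e ⊢
  rw [← e]; abel

end Primitives

/-! ### The unitary flow of a skew-adjoint generator -/

section Flow

variable {𝕜 X : Type*} [RCLike 𝕜] [NormedAddCommGroup X] [InnerProductSpace 𝕜 X]

local notation "⟪" x ", " y "⟫" => inner 𝕜 x y

/-- `P` is the unitary flow of the skew-adjoint operator `B`, and `Q t` is the inverse of `P t`.
The identity `integral_eq` is only required for nonnegative times. -/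
structure IsUnitaryFlow [NormedSpace ℝ X] (B : X →ₗ.[𝕜] X) (P Q : ℝ → X →L[𝕜] X) : Prop where
  mem_graph_iff : ∀ u v : X, (u, v) ∈ B.graph ↔ ∀ x ξ, (x, ξ) ∈ B.graph → ⟪ξ, u⟫ = -⟪x, v⟫
  inner_left : ∀ t x y, ⟪P t x, y⟫ = ⟪x, Q t y⟫
  left_inv : ∀ t x, Q t (P t x) = x
  right_inv : ∀ t x, P t (Q t x) = x
  map_zero : ∀ x, P 0 x = x
  continuous : ∀ x, Continuous fun t => P t x
  continuous_inv : ∀ x, Continuous fun t => Q t x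
  integral_eq : ∀ x ξ, (x, ξ) ∈ B.graph → ∀ t, 0 ≤ t → Q t x = x - ∫ s in (0 : ℝ)..t, Q s ξ

variable {A : X →ₗ.[𝕜] X} {S : ℝ → X →L[𝕜] X}

theorem mem_neg_graph_iff {u v : X} : (u, v) ∈ (-A).graph ↔ (u, -v) ∈ A.graph := by
  rw [LinearPMap.neg_graph, Submodule.mem_map]
  constructor
  · rintro ⟨⟨a, b⟩, h, e⟩
    simp only [LinearMap.prodMap_apply, LinearMap.id_apply, LinearMap.neg_apply,
      Prod.mk.injEq] at e
    rwa [← e.1, ← e.2, neg_neg]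
  · exact fun h => ⟨_, h, by simp⟩

variable [CompleteSpace X]

/-- Being equal to its negative adjoint makes the graph maximal skew-symmetric, so membership can be
tested weakly. This is the only way solutions are shown to enter the domain. -/
theorem IsSkewAdjoint.mem_graph_iff (hA : IsSkewAdjoint A) (u v : X) :
    (u, v) ∈ A.graph ↔ ∀ x ξ, (x, ξ) ∈ A.graph → ⟪ξ, u⟫ = -⟪x, v⟫ := by
  have h1 : (u, v) ∈ A.graph ↔ (u, -v) ∈ (-A).graph := by rw [mem_neg_graph_iff, neg_neg]
  rw [h1, ← hA.2, LinearPMap.adjoint_graph_eq_graph_adjoint hA.1, Submodule.mem_adjoint_iff]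
  simp only [inner_neg_right, sub_neg_eq_add, add_eq_zero_iff_eq_neg]

theorem IsSkewAdjoint.inner_eq_neg (hA : IsSkewAdjoint A) {x ξ y η : X} (hx : (x, ξ) ∈ A.graph)
    (hy : (y, η) ∈ A.graph) : ⟪ξ, y⟫ = -⟪x, η⟫ :=
  (hA.mem_graph_iff y η).1 hy x ξ hx

theorem IsSkewAdjoint.dense (hA : IsSkewAdjoint A) : Dense {x : X | ∃ ξ, (x, ξ) ∈ A.graph} :=
  hA.1.mono fun x hx => ⟨A ⟨x, hx⟩, A.mem_graph ⟨x, hx⟩⟩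

omit [CompleteSpace X] in
theorem IsGenerator.map_mem_graph (hAS : IsGenerator A S) (hS : IsC0Semigroup S) {x ξ : X}
    (hx : (x, ξ) ∈ A.graph) {t : ℝ} (ht : 0 ≤ t) : (S t x, S t ξ) ∈ A.graph := by
  rw [hAS] at hx ⊢
  refine (((S t).continuous.tendsto ξ).comp hx).congr' ?_
  filter_upwards [self_mem_nhdsWithin] with h hh
  have h1 := hS.map_add h t (le_of_lt hh) ht
  have h2 := hS.map_add t h ht (le_of_lt hh)
  rw [add_comm, h2] at h1
  have h3 := congrArg (fun L : X →L[𝕜] X => L x) h1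
  simp only [ContinuousLinearMap.comp_apply] at h3
  simp [h3]

theorem IsC0Semigroup.adjoint_map_zero (hS : IsC0Semigroup S) (x : X) :
    (S 0).adjoint x = x := by
  refine ext_inner_left 𝕜 fun y => ?_
  rw [ContinuousLinearMap.adjoint_inner_right, hS.map_zero, ContinuousLinearMap.id_apply]

theorem IsGenerator.adjoint_map_mem_graph (hAS : IsGenerator A S) (hS : IsC0Semigroup S)
    (hA : IsSkewAdjoint A) {x ξ : X} (hx : (x, ξ) ∈ A.graph) {t : ℝ} (ht : 0 ≤ t) :
    ((S t).adjoint x, (S t).adjoint ξ) ∈ A.graph := by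
  rw [hA.mem_graph_iff]
  intro y η hy
  rw [ContinuousLinearMap.adjoint_inner_right, ContinuousLinearMap.adjoint_inner_right]
  exact hA.inner_eq_neg (hAS.map_mem_graph hS hy ht) hx

variable [NormedSpace ℝ X] [IsScalarTower ℝ 𝕜 X]

omit [CompleteSpace X] in
theorem IsGenerator.hasDerivWithinAt (hAS : IsGenerator A S) (hS : IsC0Semigroup S) {x ξ : X}
    (hx : (x, ξ) ∈ A.graph) {t : ℝ} (ht : 0 ≤ t) :
    HasDerivWithinAt (fun s => S s x) (S t ξ) (Ioi t) t := by
  rw [hasDerivWithinAt_iff_tendsto_slope' (by simp)]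
  have h1 : Tendsto (fun r : ℝ => r - t) (𝓝[>] t) (𝓝[>] 0) := by
    refine tendsto_nhdsWithin_iff.2 ⟨?_, ?_⟩
    · exact ((continuous_sub_right t).tendsto' t 0 (sub_self t)).mono_left nhdsWithin_le_nhds
    · filter_upwards [self_mem_nhdsWithin] with r hr using mem_Ioi.2 (sub_pos.2 (mem_Ioi.1 hr))
  refine (((S t).continuous.tendsto ξ).comp (((hAS x ξ).1 hx).comp h1)).congr' ?_
  filter_upwards [self_mem_nhdsWithin] with r hr
  have h2 := hS.map_add t (r - t) ht (sub_nonneg.2 (le_of_lt hr))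
  rw [add_sub_cancel] at h2
  simp only [Function.comp, slope, vsub_eq_sub, h2, ContinuousLinearMap.comp_apply, map_smul,
    map_sub]
  rw [← map_sub, ← map_inv₀, algebraMap_smul]

omit [NormedSpace ℝ X] [IsScalarTower ℝ 𝕜 X] [CompleteSpace X] in
theorem IsC0Semigroup.intervalIntegrable (hS : IsC0Semigroup S) (x : X) {t : ℝ} (ht : 0 ≤ t) :
    IntervalIntegrable (fun s => S s x) volume 0 t :=
  ((hS.continuousOn x).mono (by rw [uIcc_of_le ht]; exact Icc_subset_Ici_self)).intervalIntegrable

theorem IsGenerator.eq_add_integral (hAS : IsGenerator A S) (hS : IsC0Semigroup S) {x ξ : X}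
    (hx : (x, ξ) ∈ A.graph) {t : ℝ} (ht : 0 ≤ t) :
    S t x = x + ∫ s in (0 : ℝ)..t, S s ξ := by
  rw [intervalIntegral.integral_eq_sub_of_hasDeriv_right_of_le ht
    ((hS.continuousOn x).mono Icc_subset_Ici_self)
    (fun s hs => hAS.hasDerivWithinAt hS hx hs.1.le) (hS.intervalIntegrable ξ ht), hS.map_zero]
  simp

/-- A family of operators that commutes with a skew-symmetric relation and satisfies the integrated
evolution equation on it is isometric. -/
theorem norm_map_of_eq_add_integral {R : ℝ → X →L[𝕜] X} {G : Submodule 𝕜 (X × X)} {c : ℝ}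
    (hG : ∀ x ξ y η, (x, ξ) ∈ G → (y, η) ∈ G → ⟪ξ, y⟫ = -⟪x, η⟫)
    (hd : Dense {x : X | ∃ ξ, (x, ξ) ∈ G}) {t : ℝ}
    (hc : ∀ x, IntervalIntegrable (fun s => R s x) volume 0 t) (h0 : ∀ x, R 0 x = x) (ht : 0 ≤ t)
    (hR : ∀ x ξ, (x, ξ) ∈ G → ∀ s, 0 ≤ s → (R s x, R s ξ) ∈ G)
    (hi : ∀ x ξ, (x, ξ) ∈ G → ∀ s, 0 ≤ s → R s x = x + c • ∫ r in (0 : ℝ)..s, R r ξ) (x : X) :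
    ‖R t x‖ = ‖x‖ := by
  refine hd.induction (P := fun x => ‖R t x‖ = ‖x‖) ?_ ?_ x
  · rintro x ⟨ξ, hx⟩
    have hprim : ∀ s ∈ uIcc 0 t, R s x = R 0 x + ∫ r in (0 : ℝ)..s, c • R r ξ := by
      intro s hs
      rw [uIcc_of_le ht] at hs
      rw [intervalIntegral.integral_smul, h0, hi x ξ hx s hs.1]
    have hcs : IntervalIntegrable (fun s => c • R s ξ) volume 0 t := (hc ξ).smul c
    have h := inner_primitive_sub (𝕜 := 𝕜) hcs hcs hprim hprim
    -- Skew symmetry makes the two terms cancel: the derivative of `‖R s x‖²` is zero.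
    have hz : ∫ s in (0 : ℝ)..t, (⟪c • R s ξ, R s x⟫ + ⟪R s x, c • R s ξ⟫) = 0 := by
      rw [← intervalIntegral.integral_zero (a := 0) (b := t) (μ := volume) (E := 𝕜)]
      refine intervalIntegral.integral_congr fun s hs => ?_
      rw [uIcc_of_le ht] at hs
      have hs' := hR x ξ hx s hs.1
      have := hG _ _ _ _ hs' hs'
      simp only [RCLike.real_smul_eq_coe_smul (K := 𝕜) c, inner_smul_left, inner_smul_right, this,
        RCLike.conj_ofReal]
      ring
    rw [hz, sub_eq_zero, h0, inner_self_eq_norm_sq_to_K, inner_self_eq_norm_sq_to_K] at h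
    norm_cast at h
    exact (sq_eq_sq₀ (norm_nonneg _) (norm_nonneg _)).1 h
  · exact isClosed_eq (R t).continuous.norm continuous_norm

theorem IsGenerator.norm_map (hAS : IsGenerator A S) (hS : IsC0Semigroup S) (hA : IsSkewAdjoint A)
    {t : ℝ} (ht : 0 ≤ t) (x : X) : ‖S t x‖ = ‖x‖ :=
  norm_map_of_eq_add_integral (G := A.graph) (c := 1) (fun _ _ _ _ h h' => hA.inner_eq_neg h h')
    hA.dense (fun x => hS.intervalIntegrable x ht) (fun x => by simp [hS.map_zero]) ht
    (fun _ _ h _ hs => hAS.map_mem_graph hS h hs)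
    (fun _ _ h _ hs => by rw [one_smul, hAS.eq_add_integral hS h hs]) x

theorem IsGenerator.adjoint_comp (hAS : IsGenerator A S) (hS : IsC0Semigroup S)
    (hA : IsSkewAdjoint A) {t : ℝ} (ht : 0 ≤ t) (x : X) : (S t).adjoint (S t x) = x := by
  have h := (ContinuousLinearMap.norm_map_iff_adjoint_comp_self (S t)).1 (hAS.norm_map hS hA ht)
  exact congrArg (fun L : X →L[𝕜] X => L x) h

theorem IsGenerator.norm_adjoint_le (hAS : IsGenerator A S) (hS : IsC0Semigroup S)
    (hA : IsSkewAdjoint A) {t : ℝ} (ht : 0 ≤ t) (x : X) : ‖(S t).adjoint x‖ ≤ ‖x‖ := by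
  refine ((S t).adjoint.le_opNorm x).trans ?_
  rw [LinearIsometryEquiv.norm_map]
  refine mul_le_of_le_one_left (norm_nonneg _) ((S t).opNorm_le_bound zero_le_one fun y => ?_)
  rw [hAS.norm_map hS hA ht, one_mul]

/-- The adjoint semigroup is strongly continuous. -/
theorem IsGenerator.continuousOn_adjoint (hAS : IsGenerator A S) (hS : IsC0Semigroup S)
    (hA : IsSkewAdjoint A) (x : X) : ContinuousOn (fun t => (S t).adjoint x) (Ici 0) := by
  have key : ∀ s t : ℝ, 0 ≤ s → s ≤ t →
      ‖(S t).adjoint x - (S s).adjoint x‖ ≤ ‖(S (t - s)).adjoint x - x‖ := by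
    intro s t hs hst
    have h := hS.map_add (t - s) s (sub_nonneg.2 hst) hs
    rw [sub_add_cancel] at h
    rw [h, ContinuousLinearMap.adjoint_comp, ContinuousLinearMap.comp_apply, ← map_sub]
    exact hAS.norm_adjoint_le hS hA hs _
  -- Expanding the square and using contractivity reduces strong continuity of the adjoints at `0`
  -- to weak continuity, which is that of `S`.
  have hsq : ∀ t : ℝ, 0 ≤ t →
      ‖(S t).adjoint x - x‖ ^ 2 ≤ 2 * (‖x‖ ^ 2 - RCLike.re ⟪S t x, x⟫) := by
    intro t ht
    have h1 := hAS.norm_adjoint_le hS hA ht x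
    have h2 := norm_sub_sq (𝕜 := 𝕜) ((S t).adjoint x) x
    rw [ContinuousLinearMap.adjoint_inner_left, ← inner_conj_symm, RCLike.conj_re] at h2
    nlinarith [norm_nonneg ((S t).adjoint x)]
  have hlim : Tendsto (fun h => ‖(S h).adjoint x - x‖) (𝓝[≥] 0) (𝓝 0) := by
    have h1 : Tendsto (fun h => 2 * (‖x‖ ^ 2 - RCLike.re ⟪S h x, x⟫)) (𝓝[≥] (0 : ℝ)) (𝓝 0) := by
      have h2 : ContinuousWithinAt (fun h => 2 * (‖x‖ ^ 2 - RCLike.re ⟪S h x, x⟫)) (Ici 0) 0 := by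
        have h := hS.continuousOn x 0 (by simp)
        exact continuousWithinAt_const.mul (continuousWithinAt_const.sub
          (RCLike.continuous_re.continuousAt.comp_continuousWithinAt
            (h.inner (𝕜 := 𝕜) continuousWithinAt_const)))
      have h3 := h2.tendsto
      simpa [hS.map_zero, inner_self_eq_norm_sq] using h3
    have h4 : Tendsto (fun h => ‖(S h).adjoint x - x‖ ^ 2) (𝓝[≥] (0 : ℝ)) (𝓝 0) := by
      refine squeeze_zero' (Eventually.of_forall fun _ => sq_nonneg _) ?_ h1
      filter_upwards [self_mem_nhdsWithin] with t ht using hsq t ht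
    simpa [Real.sqrt_sq] using h4.sqrt
  intro t ht
  refine tendsto_iff_norm_sub_tendsto_zero.2 ?_
  have habs : Tendsto (fun s => |s - t|) (𝓝[Ici 0] t) (𝓝[≥] 0) := by
    refine tendsto_nhdsWithin_iff.2 ⟨?_, Eventually.of_forall fun s => mem_Ici.2 (abs_nonneg _)⟩
    have : Continuous fun s : ℝ => |s - t| := by fun_prop
    exact (this.tendsto' t 0 (by simp)).mono_left nhdsWithin_le_nhds
  refine squeeze_zero' (Eventually.of_forall fun _ => norm_nonneg _) ?_ (hlim.comp habs)
  filter_upwards [self_mem_nhdsWithin] with s hs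
  rcases le_total s t with h | h
  · rw [norm_sub_rev, Function.comp, abs_of_nonpos (sub_nonpos.2 h), neg_sub]
    exact key s t hs h
  · rw [Function.comp, abs_of_nonneg (sub_nonneg.2 h)]
    exact key t s ht h

theorem IsGenerator.intervalIntegrable_adjoint (hAS : IsGenerator A S) (hS : IsC0Semigroup S)
    (hA : IsSkewAdjoint A) (x : X) {t : ℝ} (ht : 0 ≤ t) :
    IntervalIntegrable (fun s => (S s).adjoint x) volume 0 t :=
  ((hAS.continuousOn_adjoint hS hA x).mono
    (by rw [uIcc_of_le ht]; exact Icc_subset_Ici_self)).intervalIntegrable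

theorem IsGenerator.adjoint_eq_sub_integral (hAS : IsGenerator A S) (hS : IsC0Semigroup S)
    (hA : IsSkewAdjoint A) {x ξ : X} (hx : (x, ξ) ∈ A.graph) {t : ℝ} (ht : 0 ≤ t) :
    (S t).adjoint x = x - ∫ s in (0 : ℝ)..t, (S s).adjoint ξ := by
  refine hA.dense.eq_of_inner_right 𝕜 ?_
  rintro y ⟨η, hy⟩
  rw [inner_sub_right, ContinuousLinearMap.adjoint_inner_right,
    hAS.eq_add_integral hS hy ht, inner_add_left,
    intervalIntegral_inner x (hS.intervalIntegrable η ht),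
    inner_intervalIntegral y (hAS.intervalIntegrable_adjoint hS hA ξ ht)]
  have : ∫ s in (0 : ℝ)..t, ⟪S s η, x⟫ = -∫ s in (0 : ℝ)..t, ⟪y, (S s).adjoint ξ⟫ := by
    rw [← intervalIntegral.integral_neg]
    refine intervalIntegral.integral_congr fun s hs => ?_
    rw [uIcc_of_le ht] at hs
    simp only [ContinuousLinearMap.adjoint_inner_right]
    exact hA.inner_eq_neg (hAS.map_mem_graph hS hy hs.1) hx
  rw [this]; ring

/-- The adjoint family obeys the evolution equation of `-A`, so it is isometric as well; this is
what makes `S t` surjective. -/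
theorem IsGenerator.comp_adjoint (hAS : IsGenerator A S) (hS : IsC0Semigroup S)
    (hA : IsSkewAdjoint A) {t : ℝ} (ht : 0 ≤ t) (x : X) : S t ((S t).adjoint x) = x := by
  have h1 : ∀ x, ‖(S t).adjoint x‖ = ‖x‖ :=
    norm_map_of_eq_add_integral (R := fun t => (S t).adjoint) (G := A.graph) (c := -1)
      (fun _ _ _ _ h h' => hA.inner_eq_neg h h') hA.dense
      (fun x => hAS.intervalIntegrable_adjoint hS hA x ht) hS.adjoint_map_zero ht
      (fun _ _ h _ hs => hAS.adjoint_map_mem_graph hS hA h hs)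
      (fun _ _ h _ hs => by rw [neg_one_smul, hAS.adjoint_eq_sub_integral hS hA h hs, sub_eq_add_neg])
  have h := (ContinuousLinearMap.norm_map_iff_adjoint_comp_self (S t).adjoint).1 h1
  rw [ContinuousLinearMap.adjoint_adjoint] at h
  exact congrArg (fun L : X →L[𝕜] X => L x) h

/-- Clamping time at `0` makes the orbits continuous on the whole line, although `S` is meaningful
only for nonnegative times. -/
theorem IsGenerator.isUnitaryFlow (hAS : IsGenerator A S) (hS : IsC0Semigroup S)
    (hA : IsSkewAdjoint A) :
    IsUnitaryFlow A (fun t => S (max t 0)) (fun t => (S (max t 0)).adjoint) where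
  mem_graph_iff := hA.mem_graph_iff
  inner_left t x y := (ContinuousLinearMap.adjoint_inner_right _ _ _).symm
  left_inv t x := hAS.adjoint_comp hS hA (le_max_right _ _) x
  right_inv t x := hAS.comp_adjoint hS hA (le_max_right _ _) x
  map_zero x := by simp [hS.map_zero]
  continuous x := (hS.continuousOn x).comp_continuous (by fun_prop) fun t => mem_Ici.2 (le_max_right _ _)
  continuous_inv x := (hAS.continuousOn_adjoint hS hA x).comp_continuous (by fun_prop)
    fun t => mem_Ici.2 (le_max_right _ _)
  integral_eq x ξ hx t ht := by
    rw [max_eq_left ht, hAS.adjoint_eq_sub_integral hS hA hx ht]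
    congr 1
    refine intervalIntegral.integral_congr fun s hs => ?_
    rw [uIcc_of_le ht] at hs
    simp only [max_eq_left hs.1]

theorem IsGenerator.isUnitaryFlow_neg (hAS : IsGenerator A S) (hS : IsC0Semigroup S)
    (hA : IsSkewAdjoint A) :
    IsUnitaryFlow (-A) (fun t => (S (max t 0)).adjoint) (fun t => S (max t 0)) where
  mem_graph_iff u v := by
    rw [mem_neg_graph_iff, hA.mem_graph_iff]
    constructor
    · intro h x ξ hx
      have := h x (-ξ) (mem_neg_graph_iff.1 hx)
      rw [inner_neg_left, inner_neg_right, neg_neg] at this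
      rw [← this, neg_neg]
    · intro h x ξ hx
      have := h x (-ξ) (mem_neg_graph_iff.2 (by rwa [neg_neg]))
      rw [inner_neg_left, neg_inj] at this
      rw [this, inner_neg_right, neg_neg]
  inner_left t x y := ContinuousLinearMap.adjoint_inner_left _ _ _
  left_inv t x := hAS.comp_adjoint hS hA (le_max_right _ _) x
  right_inv t x := hAS.adjoint_comp hS hA (le_max_right _ _) x
  map_zero x := by simp [hS.adjoint_map_zero]
  continuous := (hAS.isUnitaryFlow hS hA).continuous_inv
  continuous_inv := (hAS.isUnitaryFlow hS hA).continuous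
  integral_eq x ξ hx t ht := by
    rw [max_eq_left ht, hAS.eq_add_integral hS (mem_neg_graph_iff.1 hx) ht, sub_eq_add_neg,
      ← intervalIntegral.integral_neg]
    congr 1
    refine intervalIntegral.integral_congr fun s hs => ?_
    rw [uIcc_of_le ht] at hs
    simp only [max_eq_left hs.1, map_neg]

end Flow

/-! ### Mild solutions: time reversal, variation of constants, uniqueness -/

section Mild

variable {𝕜 X : Type*} [RCLike 𝕜] [NormedAddCommGroup X] [InnerProductSpace 𝕜 X]
  [NormedSpace ℝ X] {B : X →ₗ.[𝕜] X} {g g' z z' : ℝ → X} {T : ℝ}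

local notation "⟪" x ", " y "⟫" => inner 𝕜 x y

theorem intervalIntegrable_of_continuousOn_Icc {E : Type*} [NormedAddCommGroup E] {f : ℝ → E}
    {t : ℝ} (hf : ContinuousOn f (Icc 0 T)) (ht : t ∈ Icc 0 T) :
    IntervalIntegrable f volume 0 t :=
  (hf.mono (by rw [uIcc_of_le ht.1]; exact Icc_subset_Icc_right ht.2)).intervalIntegrable

theorem IsMildSolution.intervalIntegrable (h : IsMildSolution B g T z) {t : ℝ}
    (ht : t ∈ Icc 0 T) : IntervalIntegrable z volume 0 t :=
  intervalIntegrable_of_continuousOn_Icc h.continuousOn ht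

theorem _root_.IntervalIntegrable.of_mem_Icc {E : Type*} [NormedAddCommGroup E] {f : ℝ → E}
    {t : ℝ} (hf : IntervalIntegrable f volume 0 T) (ht : t ∈ Icc 0 T) :
    IntervalIntegrable f volume 0 t :=
  hf.mono_set (uIcc_subset_uIcc left_mem_uIcc (Icc_subset_uIcc ht))

theorem IsMildSolution.mono (h : IsMildSolution B g T z) {t : ℝ} (ht : t ∈ Icc 0 T) :
    IsMildSolution B g t z where
  continuousOn := h.continuousOn.mono (Icc_subset_Icc_right ht.2)
  integrable := h.integrable.of_mem_Icc ht
  mem_graph s hs := h.mem_graph s ⟨hs.1, hs.2.trans ht.2⟩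

theorem IsMildSolution.sub (h : IsMildSolution B g T z) (h' : IsMildSolution B g' T z') :
    IsMildSolution B (fun t => g t - g' t) T (fun t => z t - z' t) where
  continuousOn := h.continuousOn.sub h'.continuousOn
  integrable := h.integrable.sub h'.integrable
  mem_graph t ht := by
    rw [intervalIntegral.integral_sub (h.intervalIntegrable ht) (h'.intervalIntegrable ht),
      intervalIntegral.integral_sub (h.integrable.of_mem_Icc ht) (h'.integrable.of_mem_Icc ht)]
    convert! B.graph.sub_mem (h.mem_graph t ht) (h'.mem_graph t ht) using 1
    rw [Prod.mk_sub_mk]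
    congr 1
    abel

theorem IsMildSolution.congr (h : IsMildSolution B g T z) (hT : 0 ≤ T)
    (hg : EqOn g g' (Icc 0 T)) : IsMildSolution B g' T z where
  continuousOn := h.continuousOn
  integrable := h.integrable.congr fun s hs =>
    hg (by rw [uIoc_of_le hT] at hs; exact Ioc_subset_Icc_self hs)
  mem_graph t ht := by
    have e : ∫ s in (0 : ℝ)..t, g' s = ∫ s in (0 : ℝ)..t, g s := by
      refine intervalIntegral.integral_congr fun s hs => (hg ?_).symm
      rw [uIcc_of_le ht.1] at hs
      exact ⟨hs.1, hs.2.trans ht.2⟩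
    rw [e]
    exact h.mem_graph t ht

/-- Reversing time turns mild solutions for `-B` into mild solutions for `B`. -/
theorem IsMildSolution.comp_sub_left (h : IsMildSolution (-B) g T z) (hT : 0 ≤ T) :
    IsMildSolution B (fun t => -g (T - t)) T (fun t => z (T - t)) where
  continuousOn := h.continuousOn.comp (by fun_prop) fun t ht =>
    mem_Icc.2 ⟨sub_nonneg.2 ht.2, sub_le_self T ht.1⟩
  integrable := by
    have := h.integrable.comp_sub_left T
    rw [sub_zero, sub_self] at this
    exact this.symm.neg
  mem_graph t ht := by
    have hTt : T - t ∈ Icc 0 T := ⟨sub_nonneg.2 ht.2, sub_le_self T ht.1⟩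
    have hTT : T ∈ Icc 0 T := ⟨hT, le_rfl⟩
    -- The integral of `z (T - s)` over `[0, t]` is that of `z` over `[T - t, T]`, hence a
    -- difference of two integrals in the domain.
    have h1 := mem_neg_graph_iff.1
      ((-B).graph.sub_mem (h.mem_graph T hTT) (h.mem_graph (T - t) hTt))
    rw [intervalIntegral.integral_neg, intervalIntegral.integral_comp_sub_left (fun s => z s),
      intervalIntegral.integral_comp_sub_left (fun s => g s), sub_zero,
      ← integral_primitive_sub (h.intervalIntegrable hTT) (Icc_subset_uIcc hTt) right_mem_uIcc,
      ← integral_primitive_sub h.integrable (Icc_subset_uIcc hTt) right_mem_uIcc]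
    convert! h1 using 2
    simp only
    generalize T - t = r
    abel

variable [CompleteSpace X] {P Q : ℝ → X →L[𝕜] X}

omit [CompleteSpace X] in
theorem IsUnitaryFlow.inner_map (hB : IsUnitaryFlow B P Q) (t : ℝ) (x y : X) :
    ⟪P t x, P t y⟫ = ⟪x, y⟫ := by rw [hB.inner_left, hB.left_inv]

omit [CompleteSpace X] in
theorem IsUnitaryFlow.inner_inv_map (hB : IsUnitaryFlow B P Q) (t : ℝ) (x y : X) :
    ⟪Q t x, Q t y⟫ = ⟪x, y⟫ := by rw [← hB.inner_left, hB.right_inv]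

omit [CompleteSpace X] in
theorem IsUnitaryFlow.inv_inner (hB : IsUnitaryFlow B P Q) (t : ℝ) (x y : X) :
    ⟪Q t x, y⟫ = ⟪x, P t y⟫ := by rw [← hB.inner_inv_map t x, hB.left_inv]

omit [CompleteSpace X] in
theorem IsUnitaryFlow.inv_map_zero (hB : IsUnitaryFlow B P Q) (x : X) : Q 0 x = x := by
  rw [← hB.map_zero (Q 0 x), hB.right_inv]

omit [NormedSpace ℝ X] [CompleteSpace X] in
-- Isometries are equicontinuous, so strong continuity upgrades to joint continuity.
theorem continuous_uncurry_of_inner_map {R : ℝ → X →L[𝕜] X}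
    (hR : ∀ t x y, ⟪R t x, R t y⟫ = ⟪x, y⟫) (hc : ∀ x, Continuous fun t => R t x) :
    Continuous fun p : ℝ × X => R p.1 p.2 := by
  have hn : ∀ t x, ‖R t x‖ = ‖x‖ := fun t x => by
    rw [← sq_eq_sq₀ (norm_nonneg _) (norm_nonneg _), ← inner_self_eq_norm_sq (𝕜 := 𝕜),
      ← inner_self_eq_norm_sq (𝕜 := 𝕜), hR]
  rw [continuous_iff_continuousAt]
  rintro ⟨t₀, x₀⟩
  refine tendsto_iff_norm_sub_tendsto_zero.2 ?_
  have hlim : Tendsto (fun p : ℝ × X => ‖p.2 - x₀‖ + ‖R p.1 x₀ - R t₀ x₀‖) (𝓝 (t₀, x₀)) (𝓝 0) := by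
    have h1 := (hc x₀).comp (continuous_fst (X := ℝ) (Y := X))
    have : Continuous fun p : ℝ × X => ‖p.2 - x₀‖ + ‖R p.1 x₀ - R t₀ x₀‖ := by
      exact ((continuous_snd.sub continuous_const).norm).add ((h1.sub continuous_const).norm)
    exact this.tendsto' _ _ (by simp)
  refine squeeze_zero (fun _ => norm_nonneg _) (fun p => ?_) hlim
  calc ‖R p.1 p.2 - R t₀ x₀‖ = ‖R p.1 (p.2 - x₀) + (R p.1 x₀ - R t₀ x₀)‖ := by
        rw [map_sub]; congr 1; abel
    _ ≤ _ := (norm_add_le _ _).trans (by rw [hn])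

omit [CompleteSpace X] in
theorem IsUnitaryFlow.continuous_uncurry (hB : IsUnitaryFlow B P Q) :
    Continuous fun p : ℝ × X => P p.1 p.2 :=
  continuous_uncurry_of_inner_map hB.inner_map hB.continuous

omit [CompleteSpace X] in
theorem IsUnitaryFlow.continuous_uncurry_inv (hB : IsUnitaryFlow B P Q) :
    Continuous fun p : ℝ × X => Q p.1 p.2 :=
  continuous_uncurry_of_inner_map hB.inner_inv_map hB.continuous_inv

omit [CompleteSpace X] in
theorem IsUnitaryFlow.norm_inv_map (hB : IsUnitaryFlow B P Q) (t : ℝ) (x : X) :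
    ‖Q t x‖ = ‖x‖ := by
  rw [← sq_eq_sq₀ (norm_nonneg _) (norm_nonneg _), ← inner_self_eq_norm_sq (𝕜 := 𝕜),
    ← inner_self_eq_norm_sq (𝕜 := 𝕜), hB.inner_inv_map]

omit [CompleteSpace X] in
theorem IsUnitaryFlow.norm_map (hB : IsUnitaryFlow B P Q) (t : ℝ) (x : X) :
    ‖P t x‖ = ‖x‖ := by
  rw [← hB.norm_inv_map t, hB.left_inv]

omit [CompleteSpace X] in
theorem IsUnitaryFlow.intervalIntegrable_inv (hB : IsUnitaryFlow B P Q) {a b : ℝ}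
    (hg : IntervalIntegrable g volume a b) :
    IntervalIntegrable (fun s => Q s (g s)) volume a b := by
  rw [intervalIntegrable_iff] at hg ⊢
  refine Integrable.mono hg ?_ (Eventually.of_forall fun s => (hB.norm_inv_map s _).le)
  exact hB.continuous_uncurry_inv.comp_aestronglyMeasurable
    (aestronglyMeasurable_id.prodMk hg.aestronglyMeasurable)

/-- The variation of constants formula yields a mild solution. -/
theorem IsUnitaryFlow.isMildSolution (hB : IsUnitaryFlow B P Q) (hT : 0 ≤ T)
    (hg : IntervalIntegrable g volume 0 T) (x : X) :
    IsMildSolution B g T (fun t => P t (x + ∫ s in (0 : ℝ)..t, Q s (g s))) := by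
  have hQg := hB.intervalIntegrable_inv hg
  have hc : ContinuousOn (fun t => P t (x + ∫ s in (0 : ℝ)..t, Q s (g s))) (Icc 0 T) := by
    have h1 := intervalIntegral.continuousOn_primitive_interval' hQg left_mem_uIcc
    rw [uIcc_of_le hT] at h1
    exact hB.continuous_uncurry.comp_continuousOn
      (continuousOn_id.prodMk (continuousOn_const.add h1))
  refine ⟨hc, hg, fun t ht => ?_⟩
  rw [hB.mem_graph_iff]
  intro y η hy
  have hcη : IntervalIntegrable (fun s => -Q s η) volume 0 t :=
    ((hB.continuous_inv η).intervalIntegrable _ _).neg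
  -- Both factors are pulled back by the flow: at time `s` the pairing equals that of `y` with the
  -- candidate solution.
  have h := inner_primitive_sub (𝕜 := 𝕜) (a := fun s => Q s y)
    (b := fun t => x + ∫ s in (0 : ℝ)..t, Q s (g s)) hcη (hQg.of_mem_Icc ht) ?_ ?_
  · have hz := intervalIntegrable_of_continuousOn_Icc hc ht
    have e : ∫ s in (0 : ℝ)..t, (⟪-Q s η, x + ∫ r in (0 : ℝ)..s, Q r (g r)⟫ + ⟪Q s y, Q s (g s)⟫) =
        -⟪η, ∫ s in (0 : ℝ)..t, P s (x + ∫ r in (0 : ℝ)..s, Q r (g r))⟫ +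
          ⟪y, ∫ s in (0 : ℝ)..t, g s⟫ := by
      rw [inner_intervalIntegral η hz, inner_intervalIntegral y (hg.of_mem_Icc ht),
        ← intervalIntegral.integral_neg, ← intervalIntegral.integral_add]
      · refine intervalIntegral.integral_congr fun s _ => ?_
        simp only [hB.inner_inv_map, inner_neg_left]
        rw [hB.inv_inner]
      · exact (intervalIntegrable_inner' continuousOn_const hz).neg
      · exact intervalIntegrable_inner' continuousOn_const (hg.of_mem_Icc ht)
    rw [e] at h
    simp only [intervalIntegral.integral_same, add_zero] at h
    rw [hB.inv_inner, hB.inv_map_zero] at h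
    rw [inner_sub_right, inner_sub_right]
    simp only [intervalIntegral.integral_same, add_zero, hB.map_zero]
    rw [h]
    ring
  · intro s hs
    rw [uIcc_of_le ht.1] at hs
    rw [intervalIntegral.integral_neg, hB.integral_eq y η hy s hs.1, hB.integral_eq y η hy 0 le_rfl]
    simp [sub_eq_add_neg]
  · intro s _
    simp

/-- The primitive `u` of the difference satisfies `u' = B u` with `u(0) = 0`. Skew symmetry keeps
`‖u‖` constant, so `u = 0`, and then `B u = z - z'` vanishes. -/
theorem IsUnitaryFlow.eqOn (hB : IsUnitaryFlow B P Q)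
    (h : IsMildSolution B g T z) (h' : IsMildSolution B g T z') (h0 : z 0 = z' 0) :
    EqOn z z' (Icc 0 T) := by
  have hd := h.sub h'
  have hmem : ∀ s ∈ Icc 0 T, (∫ r in (0 : ℝ)..s, (z r - z' r), z s - z' s) ∈ B.graph := by
    intro s hs
    have := hd.mem_graph s hs
    simpa [h0] using this
  intro t ht
  have hint : IntervalIntegrable (fun s => z s - z' s) volume 0 t := hd.intervalIntegrable ht
  have hp := inner_primitive_sub (𝕜 := 𝕜) (a := fun t => ∫ r in (0 : ℝ)..t, (z r - z' r))
    (b := fun t => ∫ r in (0 : ℝ)..t, (z r - z' r)) hint hint (by simp) (by simp)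
  have e : ∫ s in (0 : ℝ)..t, (⟪z s - z' s, ∫ r in (0 : ℝ)..s, (z r - z' r)⟫ +
      ⟪∫ r in (0 : ℝ)..s, (z r - z' r), z s - z' s⟫) = 0 := by
    rw [← intervalIntegral.integral_zero (a := 0) (b := t) (μ := volume) (E := 𝕜)]
    refine intervalIntegral.integral_congr fun s hs => ?_
    rw [uIcc_of_le ht.1] at hs
    have hs' := hmem s ⟨hs.1, hs.2.trans ht.2⟩
    simp only [(hB.mem_graph_iff _ _).1 hs' _ _ hs', neg_add_cancel]
  rw [e] at hp
  simp only [intervalIntegral.integral_same, inner_zero_left, sub_zero, inner_self_eq_zero] at hp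
  exact sub_eq_zero.1 (B.graph_fst_eq_zero_snd (hmem t ht) hp)

theorem IsUnitaryFlow.inv_apply_eq (hB : IsUnitaryFlow B P Q) (h : IsMildSolution B g T z)
    {t : ℝ} (ht : t ∈ Icc 0 T) : Q t (z t) = z 0 + ∫ s in (0 : ℝ)..t, Q s (g s) := by
  have h1 := hB.eqOn h (hB.isMildSolution (ht.1.trans ht.2) h.integrable (z 0))
    (by simp [hB.map_zero]) ht
  rw [h1, hB.left_inv]

/-- The product rule for mild solutions of a skew-adjoint operator. -/
theorem IsUnitaryFlow.inner_sub_inner (hB : IsUnitaryFlow B P Q) (hT : 0 ≤ T)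
    (h : IsMildSolution B g T z) (h' : IsMildSolution B g' T z') :
    ⟪z T, z' T⟫ - ⟪z 0, z' 0⟫ = ∫ s in (0 : ℝ)..T, (⟪g s, z' s⟫ + ⟪z s, g' s⟫) := by
  have hp := inner_primitive_sub (𝕜 := 𝕜) (a := fun t => Q t (z t)) (b := fun t => Q t (z' t))
    (hB.intervalIntegrable_inv h.integrable) (hB.intervalIntegrable_inv h'.integrable) ?_ ?_
  · simpa only [hB.inner_inv_map] using hp
  · intro t ht
    rw [uIcc_of_le hT] at ht
    rw [hB.inv_apply_eq h ht, hB.inv_map_zero]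
  · intro t ht
    rw [uIcc_of_le hT] at ht
    rw [hB.inv_apply_eq h' ht, hB.inv_map_zero]

end Mild

/-! ### Volterra equations and bounded feedback -/

/-- A Volterra integral equation with a globally Lipschitz nonlinearity is solvable. -/
theorem exists_volterra {E : Type*} [NormedAddCommGroup E] [NormedSpace ℝ E] [CompleteSpace E]
    {N : ℝ → E → E} {F : ℝ → E} {T k : ℝ} (hT : 0 ≤ T) (hk : 0 ≤ k)
    (hN : Continuous fun p : ℝ × E => N p.1 p.2)
    (hL : ∀ s x y, ‖N s x - N s y‖ ≤ k * ‖x - y‖) (hF : ContinuousOn F (Icc 0 T)) :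
    ∃ a : ℝ → E, ContinuousOn a (Icc 0 T) ∧
      ∀ t ∈ Icc 0 T, a t = F t + ∫ s in (0 : ℝ)..t, N s (a s) := by
  -- Exponential weight: writing the unknown as `exp (l t) d(t)` gives Lipschitz constant at most `k
  -- / l ≤ 1/2`, whatever the length of the interval.
  set l : ℝ := 2 * k + 1
  have hl : 0 < l := by positivity
  set e : C(Icc 0 T, E) → ℝ → E := fun d t => Real.exp (l * t) • IccExtend hT d t
  have he : ∀ d, Continuous (e d) := fun d =>
    (by fun_prop : Continuous fun t => Real.exp (l * t)).smul d.continuous.Icc_extend'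
  have hNe : ∀ d, Continuous fun s => N s (e d s) := fun d =>
    hN.comp (continuous_id.prodMk (he d))
  set Ψ : C(Icc 0 T, E) → C(Icc 0 T, E) := fun d =>
    ⟨fun t => Real.exp (-(l * t)) • (F t + ∫ s in (0 : ℝ)..t, N s (e d s)), by
      have h1 : Continuous fun t : ℝ => ∫ s in (0 : ℝ)..t, N s (e d s) :=
        intervalIntegral.continuous_primitive (fun a b => (hNe d).intervalIntegrable a b) 0
      have h2 : Continuous fun t : Icc 0 T => F t := continuousOn_iff_continuous_domRestrict.1 hF
      exact (by fun_prop : Continuous fun t : Icc 0 T => Real.exp (-(l * t))).smul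
        (h2.add (h1.comp continuous_subtype_val))⟩
  have hΨ : ContractingWith (1 / 2) Ψ := by
    refine ⟨by norm_num, LipschitzWith.of_dist_le_mul fun d d' => ?_⟩
    rw [ContinuousMap.dist_le (by positivity)]
    rintro ⟨t, ht⟩
    have hexp : ∫ s in (0 : ℝ)..t, Real.exp (l * s) = (Real.exp (l * t) - 1) / l := by
      rw [intervalIntegral.integral_comp_mul_left (fun s => Real.exp s) hl.ne', integral_exp]
      simp [div_eq_inv_mul]
    have hint : ‖∫ s in (0 : ℝ)..t, (N s (e d s) - N s (e d' s))‖ ≤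
        ∫ s in (0 : ℝ)..t, k * dist d d' * Real.exp (l * s) := by
      refine intervalIntegral.norm_integral_le_of_norm_le ht.1 (Eventually.of_forall fun s hs => ?_)
        ((by fun_prop : Continuous fun s => k * dist d d' * Real.exp (l * s)).intervalIntegrable _ _)
      have hs' : s ∈ Icc 0 T := ⟨hs.1.le, hs.2.trans ht.2⟩
      refine (hL s _ _).trans ?_
      simp only [e]
      rw [← smul_sub, norm_smul, Real.norm_of_nonneg (Real.exp_pos _).le, IccExtend_of_mem _ _ hs',
        IccExtend_of_mem _ _ hs', ← dist_eq_norm, mul_assoc, mul_comm (Real.exp _)]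
      gcongr
      exact ContinuousMap.dist_apply_le_dist _
    rw [intervalIntegral.integral_const_mul, hexp] at hint
    simp only [Ψ, ContinuousMap.coe_mk, dist_eq_norm]
    rw [← smul_sub, add_sub_add_left_eq_sub, ← intervalIntegral.integral_sub
      ((hNe d).intervalIntegrable _ _) ((hNe d').intervalIntegrable _ _), norm_smul,
      Real.norm_of_nonneg (Real.exp_pos _).le, Real.exp_neg, inv_mul_le_iff₀ (Real.exp_pos _)]
    refine hint.trans ?_
    rw [← dist_eq_norm]
    have h1 : (Real.exp (l * t) - 1) / l * k ≤ Real.exp (l * t) * (1 / 2) := by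
      rw [div_mul_eq_mul_div, div_le_iff₀ hl]
      have := Real.exp_pos (l * t)
      simp only [l]
      nlinarith
    have h2 := mul_le_mul_of_nonneg_right h1 (dist_nonneg (x := d) (y := d'))
    push_cast
    linarith
  obtain ⟨d, hd, -⟩ := hΨ.exists_fixedPoint 0 (edist_ne_top _ _)
  refine ⟨e d, (he d).continuousOn, fun t ht => ?_⟩
  have h1 := congrArg (fun c : C(Icc 0 T, E) => c ⟨t, ht⟩) hd
  simp only [Ψ, ContinuousMap.coe_mk] at h1
  have h2 : e d t = Real.exp (l * t) • d ⟨t, ht⟩ := by simp only [e, IccExtend_of_mem _ _ ht]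
  rw [h2, ← h1, smul_smul, ← Real.exp_add, add_neg_cancel, Real.exp_zero, one_smul]

section Feedback

variable {𝕜 X : Type*} [RCLike 𝕜] [NormedAddCommGroup X] [InnerProductSpace 𝕜 X]
  [NormedSpace ℝ X] [CompleteSpace X] {B : X →ₗ.[𝕜] X} {g : ℝ → X} {T : ℝ}
  {P Q : ℝ → X →L[𝕜] X}

/-- In the variable `a(t) = Q t (z t)` the unbounded operator disappears and a Volterra equation
with Lipschitz kernel `Q s ∘ K ∘ P s` remains. -/
theorem IsUnitaryFlow.exists_isMildSolution_feedback (hB : IsUnitaryFlow B P Q) (hT : 0 ≤ T)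
    (hg : IntervalIntegrable g volume 0 T) (K : X →L[𝕜] X) (x : X) :
    ∃ z : ℝ → X, IsMildSolution B (fun t => g t + K (z t)) T z ∧ z 0 = x := by
  have hQg := hB.intervalIntegrable_inv hg
  have hF : ContinuousOn (fun t => x + ∫ s in (0 : ℝ)..t, Q s (g s)) (Icc 0 T) := by
    have h1 := intervalIntegral.continuousOn_primitive_interval' hQg left_mem_uIcc
    rw [uIcc_of_le hT] at h1
    exact continuousOn_const.add h1
  have hN : Continuous fun p : ℝ × X => Q p.1 (K (P p.1 p.2)) :=
    hB.continuous_uncurry_inv.comp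
      (continuous_fst.prodMk (K.continuous.comp hB.continuous_uncurry))
  obtain ⟨a, ha, hae⟩ := exists_volterra (N := fun s x => Q s (K (P s x))) hT (norm_nonneg K) hN (fun s x y => by
    rw [← map_sub, ← map_sub, ← map_sub, hB.norm_inv_map]
    exact (K.le_opNorm _).trans (by rw [hB.norm_map])) hF
  have hKa : ContinuousOn (fun s => K (P s (a s))) (Icc 0 T) :=
    K.continuous.comp_continuousOn
      (hB.continuous_uncurry.comp_continuousOn (continuousOn_id.prodMk ha))
  have hKi : IntervalIntegrable (fun s => K (P s (a s))) volume 0 T :=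
    intervalIntegrable_of_continuousOn_Icc hKa ⟨hT, le_rfl⟩
  have hz := hB.isMildSolution hT (hg.add hKi) x
  refine ⟨_, hz.congr hT fun t ht => ?_, by simp [hB.map_zero]⟩
  have e : x + ∫ s in (0 : ℝ)..t, Q s (g s + K (P s (a s))) = a t := by
    rw [hae t ht, add_assoc, ← intervalIntegral.integral_add (hQg.of_mem_Icc ht)
      ((hB.intervalIntegrable_inv hKi).of_mem_Icc ht)]
    simp only [map_add]
  simp only [e]

end Feedback

/-! ### Observer errors, energy balance and optimality -/

section Nudging

variable {𝕜 X Y : Type*} [RCLike 𝕜]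
  [NormedAddCommGroup X] [InnerProductSpace 𝕜 X] [CompleteSpace X] [NormedSpace ℝ X]
  [NormedAddCommGroup Y] [InnerProductSpace 𝕜 Y] [CompleteSpace Y]
  {A : X →ₗ.[𝕜] X} {C : X →L[𝕜] Y} {κ σ T : ℝ} {f : ℝ → X} {y : ℝ → Y}
  {P Q : ℝ → X →L[𝕜] X} {z z' w w' φ : ℝ → X}

local notation "⟪" x ", " y "⟫" => inner 𝕜 x y

omit [CompleteSpace X] [NormedSpace ℝ X] [CompleteSpace Y] in
theorem continuousOn_norm_sq_comp (C : X →L[𝕜] Y) {s : Set ℝ} (hφ : ContinuousOn φ s) :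
    ContinuousOn (fun t => ‖C (φ t)‖ ^ 2) s :=
  (C.continuous.comp_continuousOn hφ).norm.pow 2

theorem IsForwardSolution.sub (h : IsForwardSolution A C κ T f y z)
    (h' : IsForwardSolution A C κ T f y z') :
    IsMildSolution A (fun t => (-κ) • C.adjoint (C (z t - z' t))) T (fun t => z t - z' t) := by
  convert! IsMildSolution.sub h h' using 2 with t
  simp only [map_sub, smul_sub, neg_smul]
  abel

theorem IsBackwardSolution.sub_comp_sub_left (hT : 0 ≤ T) (h : IsBackwardSolution A C κ T f y w)
    (h' : IsBackwardSolution A C κ T f y w') :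
    IsMildSolution A (fun t => κ • C.adjoint (C (w (T - t) - w' (T - t)))) T
      (fun t => w (T - t) - w' (T - t)) := by
  convert! IsMildSolution.comp_sub_left (IsMildSolution.sub h h') hT using 2 with t
  simp only [map_sub, smul_sub]
  abel

theorem IsBackwardSolution.sub_forward (hT : 0 ≤ T) (h : IsBackwardSolution A C κ T f y w)
    (h' : IsForwardSolution A C κ T f y z) :
    IsMildSolution A (fun t => κ • C.adjoint (C (w (T - t) - z t)) -
      (2 * κ) • C.adjoint (y t - C (z t))) T (fun t => w (T - t) - z t) := by
  convert! IsMildSolution.sub (IsMildSolution.comp_sub_left h hT) h' using 2 with t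
  simp only [map_sub, smul_sub, sub_sub_cancel, two_mul, add_smul]
  abel

variable [IsScalarTower ℝ 𝕜 X]

omit [CompleteSpace X] in
theorem inner_real_smul_left (c : ℝ) (x x' : X) : ⟪c • x, x'⟫ = (c : 𝕜) * ⟪x, x'⟫ := by
  rw [RCLike.real_smul_eq_coe_smul (K := 𝕜) c, inner_smul_left, RCLike.conj_ofReal]

omit [CompleteSpace X] in
theorem inner_real_smul_right (c : ℝ) (x x' : X) : ⟪x, c • x'⟫ = (c : 𝕜) * ⟪x, x'⟫ := by
  rw [RCLike.real_smul_eq_coe_smul (K := 𝕜) c, inner_smul_right]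

/-- Energy balance for a colocated feedback. -/
theorem IsUnitaryFlow.norm_sq_sub_norm_sq (hB : IsUnitaryFlow A P Q) (hT : 0 ≤ T)
    (h : IsMildSolution A (fun t => σ • C.adjoint (C (φ t))) T φ) :
    ‖φ T‖ ^ 2 - ‖φ 0‖ ^ 2 = 2 * σ * ∫ s in (0 : ℝ)..T, ‖C (φ s)‖ ^ 2 := by
  have h1 := hB.inner_sub_inner hT h h
  have e : ∀ s, ⟪σ • C.adjoint (C (φ s)), φ s⟫ + ⟪φ s, σ • C.adjoint (C (φ s))⟫ =
      ((2 * σ * ‖C (φ s)‖ ^ 2 : ℝ) : 𝕜) := by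
    intro s
    rw [inner_real_smul_left, inner_real_smul_right, ContinuousLinearMap.adjoint_inner_left,
      ContinuousLinearMap.adjoint_inner_right, inner_self_eq_norm_sq_to_K]
    push_cast
    ring
  simp only [e] at h1
  rw [RCLike.intervalIntegral_ofReal, inner_self_eq_norm_sq_to_K, inner_self_eq_norm_sq_to_K,
    intervalIntegral.integral_const_mul] at h1
  exact_mod_cast h1

theorem IsUnitaryFlow.exists_isForwardSolution (hB : IsUnitaryFlow A P Q) (hT : 0 ≤ T)
    (hf : IntervalIntegrable f volume 0 T) (hy : IntervalIntegrable y volume 0 T) (x : X) :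
    ∃ z, IsForwardSolution A C κ T f y z ∧ z 0 = x := by
  have hCy : IntervalIntegrable (fun t => κ • C.adjoint (y t)) volume 0 T := by
    rw [intervalIntegrable_iff] at hy ⊢
    exact (C.adjoint.integrable_comp hy).smul κ
  obtain ⟨z, hz, h0⟩ := hB.exists_isMildSolution_feedback hT (hf.add hCy)
    (-((κ : 𝕜) • (C.adjoint.comp C))) x
  refine ⟨z, ?_, h0⟩
  unfold IsForwardSolution
  convert! hz using 2 with t
  simp only [map_sub, smul_sub, neg_apply, smul_apply,
    ContinuousLinearMap.comp_apply, ← RCLike.real_smul_eq_coe_smul]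
  abel

theorem IsUnitaryFlow.exists_isBackwardSolution (hB : IsUnitaryFlow (-A) P Q) (hT : 0 ≤ T)
    (hf : IntervalIntegrable f volume 0 T) (hy : IntervalIntegrable y volume 0 T) (x : X) :
    ∃ z, IsBackwardSolution A C κ T f y z ∧ z 0 = x := by
  have hf' := (hf.comp_sub_left T).symm.neg
  have hy' := (hy.comp_sub_left T).symm
  rw [sub_zero, sub_self] at hf' hy'
  exact hB.exists_isForwardSolution hT hf' hy' x

theorem IsUnitaryFlow.eqOn_forward (hB : IsUnitaryFlow A P Q) (hκ : 0 ≤ κ)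
    (h : IsForwardSolution A C κ T f y z) (h' : IsForwardSolution A C κ T f y z')
    (h0 : z 0 = z' 0) : EqOn z z' (Icc 0 T) := by
  intro t ht
  have h1 := hB.norm_sq_sub_norm_sq ht.1 ((h.sub h').mono ht)
  have h2 : 0 ≤ ∫ s in (0 : ℝ)..t, ‖C (z s - z' s)‖ ^ 2 :=
    intervalIntegral.integral_nonneg ht.1 fun s _ => by positivity
  simp only [h0, sub_self, norm_zero] at h1
  have h3 : ‖z t - z' t‖ ^ 2 ≤ 0 := by nlinarith
  exact sub_eq_zero.1 (norm_eq_zero.1 (pow_eq_zero_iff two_ne_zero |>.1 (le_antisymm h3 (sq_nonneg _))))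

/-- Exact observability is inherited by the closed loop. -/
theorem IsUnitaryFlow.exists_observability_feedback (hB : IsUnitaryFlow A P Q) (hT : 0 < T)
    (C : X →L[𝕜] Y) (κ : ℝ)
    (hobs : IsExactlyObservable P C T) :
    ∃ δ : ℝ, 0 < δ ∧ ∀ φ : ℝ → X, IsMildSolution A (fun t => (-κ) • C.adjoint (C (φ t))) T φ →
      δ * ‖φ 0‖ ^ 2 ≤ ∫ s in (0 : ℝ)..T, ‖C (φ s)‖ ^ 2 := by
  obtain ⟨δ, hδ, hobs⟩ := hobs
  have hTT : T ∈ Icc 0 T := ⟨hT.le, le_rfl⟩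
  -- With `m` the maximal deviation from the free orbit, the free output energy is at most `2I +
  -- 2T‖C‖²m²`, and `m² ≤ 4Tκ²‖C‖²I`.
  refine ⟨δ / (2 + 8 * T ^ 2 * κ ^ 2 * ‖C‖ ^ 4), by positivity, fun φ hφ => ?_⟩
  set I := ∫ s in (0 : ℝ)..T, ‖C (φ s)‖ ^ 2
  have hψ : IsMildSolution A (fun _ => (0 : X)) T (fun t => P t (φ 0)) := by
    simpa using hB.isMildSolution hT.le (g := fun _ => (0 : X)) (by simp) (φ 0)
  have hu := hφ.sub hψ
  simp only [sub_zero] at hu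
  set u : ℝ → X := fun t => φ t - P t (φ 0)
  have hu0 : u 0 = 0 := by simp [u, hB.map_zero]
  obtain ⟨t₀, ht₀, hmax⟩ := isCompact_Icc.exists_isMaxOn ⟨T, hTT⟩ hu.continuousOn.norm
  set m := ‖u t₀‖
  have hm : ∀ t ∈ Icc 0 T, ‖u t‖ ≤ m := fun t ht => hmax ht
  have hCφ := continuousOn_norm_sq_comp C hφ.continuousOn
  -- Young's inequality with weight `2T`: the constant part integrates over `[0, T]` to `m² / 2`,
  -- which is absorbed on the left.
  set b : ℝ → ℝ := fun s => 2 * T * κ ^ 2 * ‖C‖ ^ 2 * ‖C (φ s)‖ ^ 2 + m ^ 2 / (2 * T)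
  have hbc : ContinuousOn b (Icc 0 T) := (continuousOn_const.mul hCφ).add continuousOn_const
  have hbint {t : ℝ} (ht : t ∈ Icc 0 T) : IntervalIntegrable b volume 0 t :=
    intervalIntegrable_of_continuousOn_Icc hbc ht
  have hIint := intervalIntegrable_of_continuousOn_Icc hCφ hTT
  have hmI : m ^ 2 ≤ 4 * T * κ ^ 2 * ‖C‖ ^ 2 * I := by
    have h1 := hB.inner_sub_inner ht₀.1 (hu.mono ht₀) (hu.mono ht₀)
    rw [hu0, inner_zero_left, sub_zero, inner_self_eq_norm_sq_to_K] at h1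
    have h2 := congrArg norm h1
    rw [norm_pow, RCLike.norm_ofReal, abs_norm] at h2
    have h3 : ‖u t₀‖ ^ 2 ≤ ∫ s in (0 : ℝ)..t₀, b s := by
      rw [h2]
      refine intervalIntegral.norm_integral_le_of_norm_le ht₀.1
        (Eventually.of_forall fun s hs => ?_) (hbint ht₀)
      have hs' := hm s ⟨hs.1.le, hs.2.trans ht₀.2⟩
      have hC : ‖⟪C (φ s), C (u s)⟫‖ ≤ ‖C (φ s)‖ * (‖C‖ * m) :=
        (norm_inner_le_norm _ _).trans (by gcongr; exact (C.le_opNorm _).trans (by gcongr))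
      have hC' : ‖⟪C (u s), C (φ s)⟫‖ ≤ ‖C (φ s)‖ * (‖C‖ * m) := by rwa [norm_inner_symm]
      rw [inner_real_smul_left, inner_real_smul_right, ContinuousLinearMap.adjoint_inner_left,
        ContinuousLinearMap.adjoint_inner_right]
      calc _ ≤ |κ| * (‖C (φ s)‖ * (‖C‖ * m)) + |κ| * (‖C (φ s)‖ * (‖C‖ * m)) := by
            refine (norm_add_le _ _).trans ?_
            rw [norm_mul, norm_mul, RCLike.norm_ofReal, abs_neg]
            gcongr
        _ = 2 * (|κ| * ‖C‖ * ‖C (φ s)‖) * m := by ring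
        _ ≤ 2 * T * (|κ| * ‖C‖ * ‖C (φ s)‖) ^ 2 + m ^ 2 / (2 * T) := by
            set q := |κ| * ‖C‖ * ‖C (φ s)‖
            have : 2 * T * q ^ 2 + m ^ 2 / (2 * T) - 2 * q * m = (2 * T * q - m) ^ 2 / (2 * T) := by
              field_simp; ring
            have : 0 ≤ (2 * T * q - m) ^ 2 / (2 * T) := by positivity
            linarith
        _ = b s := by
            simp only [b]
            rw [mul_pow, mul_pow, sq_abs]
            ring
    have h4 : ∫ s in (0 : ℝ)..t₀, b s ≤ ∫ s in (0 : ℝ)..T, b s :=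
      intervalIntegral.integral_mono_interval le_rfl ht₀.1 ht₀.2
        (Eventually.of_forall fun s => by simp only [b, Pi.zero_apply]; positivity) (hbint hTT)
    have h5 : ∫ s in (0 : ℝ)..T, b s = 2 * T * κ ^ 2 * ‖C‖ ^ 2 * I + m ^ 2 / 2 := by
      simp only [b]
      rw [intervalIntegral.integral_add (hIint.const_mul _) (by simp),
        intervalIntegral.integral_const_mul, intervalIntegral.integral_const, smul_eq_mul]
      simp only [I]
      field_simp
      ring
    have h6 : m ^ 2 ≤ _ := h3.trans (h4.trans_eq h5)
    linarith
  have hle : ∫ s in (0 : ℝ)..T, ‖C (P s (φ 0))‖ ^ 2 ≤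
      ∫ s in (0 : ℝ)..T, (2 * ‖C (φ s)‖ ^ 2 + 2 * ‖C‖ ^ 2 * m ^ 2) := by
    refine intervalIntegral.integral_mono_on hT.le
      (intervalIntegrable_of_continuousOn_Icc (continuousOn_norm_sq_comp C hψ.continuousOn) hTT)
      ((hIint.const_mul 2).add (by simp)) fun s hs => ?_
    have h1 : C (P s (φ 0)) = C (φ s) - C (u s) := by simp [u]
    have h2 : ‖C (u s)‖ ≤ ‖C‖ * m := (C.le_opNorm _).trans (by gcongr; exact hm s hs)
    have h3 := norm_sub_le (C (φ s)) (C (u s))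
    rw [h1]
    calc _ ≤ (‖C (φ s)‖ + ‖C‖ * m) ^ 2 := by gcongr; linarith
      _ ≤ _ := by nlinarith [sq_nonneg (‖C (φ s)‖ - ‖C‖ * m)]
  rw [intervalIntegral.integral_add (hIint.const_mul _) (by simp),
    intervalIntegral.integral_const_mul, intervalIntegral.integral_const, smul_eq_mul] at hle
  rw [div_mul_eq_mul_div, div_le_iff₀ (by positivity)]
  refine (hobs (φ 0)).trans (hle.trans ?_)
  have h7 := mul_le_mul_of_nonneg_left hmI (by positivity : 0 ≤ 2 * T * ‖C‖ ^ 2)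
  simp only [I] at h7 ⊢
  nlinarith

/-- One round trip of the method contracts the distance of two runs. -/
theorem IsUnitaryFlow.norm_round_trip_le (hB : IsUnitaryFlow A P Q) (hT : 0 ≤ T) (hκ : 0 ≤ κ)
    {δ : ℝ} (hδ : ∀ φ : ℝ → X, IsMildSolution A (fun t => (-κ) • C.adjoint (C (φ t))) T φ →
      δ * ‖φ 0‖ ^ 2 ≤ ∫ s in (0 : ℝ)..T, ‖C (φ s)‖ ^ 2)
    (hz : IsForwardSolution A C κ T f y z) (hz' : IsForwardSolution A C κ T f y z')
    (hw : IsBackwardSolution A C κ T f y w) (hw' : IsBackwardSolution A C κ T f y w')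
    (h : w 0 = z T) (h' : w' 0 = z' T) :
    ‖w T - w' T‖ ≤ √(1 - 2 * κ * δ) * ‖z 0 - z' 0‖ := by
  have h1 := hB.norm_sq_sub_norm_sq hT (hz.sub hz')
  have h2 := hB.norm_sq_sub_norm_sq hT (hw.sub_comp_sub_left hT hw')
  have h3 := hδ _ (hz.sub hz')
  have h4 : 0 ≤ ∫ s in (0 : ℝ)..T, ‖C (w (T - s) - w' (T - s))‖ ^ 2 :=
    intervalIntegral.integral_nonneg hT fun s _ => by positivity
  simp only [sub_self, sub_zero, h, h'] at h1 h2 h3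
  -- The forward leg supplies the decay; the backward leg only needs to be nonexpansive. If `1 -
  -- 2κδ` is negative the left side is zero, consistent with the real square root being zero there.
  have h5 : ‖w T - w' T‖ ^ 2 ≤ (1 - 2 * κ * δ) * ‖z 0 - z' 0‖ ^ 2 := by
    nlinarith [mul_le_mul_of_nonneg_left h3 hκ, mul_nonneg hκ h4]
  rw [← Real.sqrt_sq (norm_nonneg (z 0 - z' 0)), ← Real.sqrt_mul' _ (sq_nonneg _)]
  exact Real.le_sqrt_of_sq_le h5

/-- At a fixed point of the round trip, the residual is orthogonal to all output variations. -/
theorem IsUnitaryFlow.integral_inner_eq_zero (hB : IsUnitaryFlow A P Q) (hT : 0 ≤ T) (hκ : 0 < κ)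
    (hz : IsForwardSolution A C κ T f y z) (hw : IsBackwardSolution A C κ T f y w)
    (h : w 0 = z T) (h' : w T = z 0)
    (hφ : IsMildSolution A (fun t => (-κ) • C.adjoint (C (φ t))) T φ) :
    ∫ s in (0 : ℝ)..T, inner 𝕜 (y s - C (z s)) (C (φ s)) = 0 := by
  have h1 := hB.inner_sub_inner hT (hw.sub_forward hT hz) hφ
  simp only [sub_self, sub_zero, h, h', inner_zero_left] at h1
  -- The feedback terms of the two equations have opposite signs and cancel; only the residual
  -- survives.
  have e : ∀ s, ⟪κ • C.adjoint (C (w (T - s) - z s)) - (2 * κ) • C.adjoint (y s - C (z s)), φ s⟫ +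
      ⟪w (T - s) - z s, (-κ) • C.adjoint (C (φ s))⟫ =
      -(2 * κ : 𝕜) * inner 𝕜 (y s - C (z s)) (C (φ s)) := by
    intro s
    rw [inner_sub_left, inner_real_smul_left, inner_real_smul_left, inner_real_smul_right,
      ContinuousLinearMap.adjoint_inner_left, ContinuousLinearMap.adjoint_inner_left,
      ContinuousLinearMap.adjoint_inner_right]
    push_cast
    ring
  simp only [e] at h1
  rw [intervalIntegral.integral_const_mul, eq_comm, mul_eq_zero] at h1
  refine h1.resolve_left ?_
  have : (κ : 𝕜) ≠ 0 := by exact_mod_cast hκ.ne'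
  simp [this]

omit [CompleteSpace X] [NormedSpace ℝ X] [CompleteSpace Y] [IsScalarTower ℝ 𝕜 X] in
theorem memLp_sub_comp (hy : MemLp y 2 (volume.restrict (Icc 0 T))) (hz : ContinuousOn z (Icc 0 T)) :
    MemLp (fun s => y s - C (z s)) 2 (volume.restrict (Icc 0 T)) := by
  have hc := C.continuous.comp_continuousOn hz
  obtain ⟨M, hM⟩ := isCompact_Icc.exists_bound_of_continuousOn hc
  refine hy.sub (MemLp.of_bound (hc.aestronglyMeasurable measurableSet_Icc) M ?_)
  filter_upwards [ae_restrict_mem measurableSet_Icc] with s hs using hM s hs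

omit [CompleteSpace X] [NormedSpace ℝ X] [CompleteSpace Y] [IsScalarTower ℝ 𝕜 X] in
-- Pythagoras: the cross term of the expanded square is the real part of the vanishing integral.
theorem outputCost_eq_add (hT : 0 ≤ T) (hy : MemLp y 2 (volume.restrict (Icc 0 T)))
    (hz : ContinuousOn z (Icc 0 T)) (hz' : ContinuousOn z' (Icc 0 T))
    (h0 : ∫ s in (0 : ℝ)..T, inner 𝕜 (y s - C (z s)) (C (z' s - z s)) = 0) :
    outputCost C T y z' =
      outputCost C T y z + (1 / 2) * ∫ s in (0 : ℝ)..T, ‖C (z' s - z s)‖ ^ 2 := by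
  have hr := memLp_sub_comp (C := C) hy hz
  have hφ : ContinuousOn (fun s => C (z' s - z s)) (Icc 0 T) :=
    C.continuous.comp_continuousOn (hz'.sub hz)
  have hri : IntervalIntegrable (fun s => y s - C (z s)) volume 0 T := by
    rw [intervalIntegrable_iff_integrableOn_Icc_of_le hT]
    exact hr.integrable one_le_two
  have hr2 : IntervalIntegrable (fun s => ‖y s - C (z s)‖ ^ 2) volume 0 T := by
    rw [intervalIntegrable_iff_integrableOn_Icc_of_le hT]
    exact hr.integrable_norm_pow two_ne_zero
  have hin : IntervalIntegrable (fun s => inner 𝕜 (y s - C (z s)) (C (z' s - z s))) volume 0 T :=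
    intervalIntegrable_inner hri (by rwa [uIcc_of_le hT])
  have hin' : IntervalIntegrable
      (fun s => RCLike.re (inner 𝕜 (y s - C (z s)) (C (z' s - z s)))) volume 0 T := by
    rw [intervalIntegrable_iff] at hin ⊢
    exact hin.re
  have hφ2 : IntervalIntegrable (fun s => ‖C (z' s - z s)‖ ^ 2) volume 0 T :=
    intervalIntegrable_of_continuousOn_Icc (hφ.norm.pow 2) ⟨hT, le_rfl⟩
  have hre : ∫ s in (0 : ℝ)..T, RCLike.re (inner 𝕜 (y s - C (z s)) (C (z' s - z s))) = 0 := by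
    rw [intervalIntegral.intervalIntegral_re hin, h0, map_zero]
  have e : ∫ s in (0 : ℝ)..T, ‖y s - C (z' s)‖ ^ 2 = ∫ s in (0 : ℝ)..T, (‖y s - C (z s)‖ ^ 2 -
      2 * RCLike.re (inner 𝕜 (y s - C (z s)) (C (z' s - z s))) + ‖C (z' s - z s)‖ ^ 2) := by
    refine intervalIntegral.integral_congr fun s _ => ?_
    rw [← norm_sub_sq (𝕜 := 𝕜)]
    simp
  unfold outputCost
  rw [e, intervalIntegral.integral_add (hr2.sub (hin'.const_mul 2)) hφ2,
    intervalIntegral.integral_sub hr2 (hin'.const_mul 2), intervalIntegral.integral_const_mul, hre]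
  ring

end Nudging

end BFN

/-! ### The fixed point as minimizer and limit -/

theorem mainTheorem3 {𝕜 X Y : Type*} [RCLike 𝕜]
    [NormedAddCommGroup X] [InnerProductSpace 𝕜 X] [CompleteSpace X]
    [NormedSpace ℝ X] [IsScalarTower ℝ 𝕜 X]
    [NormedAddCommGroup Y] [InnerProductSpace 𝕜 Y] [CompleteSpace Y]
    (A : X →ₗ.[𝕜] X) (S : ℝ → X →L[𝕜] X) (C : X →L[𝕜] Y) (T κ : ℝ)
    (hS : BFN.IsC0Semigroup S) (hAS : BFN.IsGenerator A S) (hA : BFN.IsSkewAdjoint A)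
    (hT : 0 < T) (hκ : 0 < κ) (hobs : BFN.IsExactlyObservable S C T) :
    -- the constants of the exponential rate do not depend on the data `f`, `y`, `x₁`
    ∃ M γ : ℝ, 0 ≤ M ∧ 0 ≤ γ ∧ γ < 1 ∧
      ∀ (f : ℝ → X) (y : ℝ → Y),
        IntervalIntegrable f volume 0 T → MemLp y 2 (volume.restrict (Icc 0 T)) →
        -- `z x` is the unique solution of the closed-loop system with initial state `x`
        ∃ z : X → ℝ → X,
          (∀ x, BFN.IsForwardSolution A C κ T f y (z x) ∧ z x 0 = x ∧
            ∀ w, BFN.IsForwardSolution A C κ T f y w → w 0 = x → EqOn w (z x) (Icc 0 T)) ∧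
          -- `xo` is the unique minimizer of the cost function
          ∃ xo : X,
            (∀ x, x ≠ xo → BFN.outputCost C T y (z xo) < BFN.outputCost C T y (z x)) ∧
            -- the method is well defined for every initial guess `x₁`, and converges to `xo`
            ∀ x₁ : X,
              (∃ zp zm : ℕ → ℝ → X,
                BFN.IsBFNRun A C (fun _ => κ) T f y zp zm ∧ zp 1 0 = x₁) ∧
              ∀ zp zm : ℕ → ℝ → X,
                BFN.IsBFNRun A C (fun _ => κ) T f y zp zm → zp 1 0 = x₁ →
                ∀ j, 1 ≤ j → ‖zm j T - xo‖ ≤ M * γ ^ j * ‖x₁ - xo‖ := by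
  obtain ⟨δ₀, hδ₀, hobs₀⟩ := hobs
  have hF := hAS.isUnitaryFlow hS hA
  have hG := hAS.isUnitaryFlow_neg hS hA
  have hobs' : BFN.IsExactlyObservable (fun t => S (max t 0)) C T := by
    refine ⟨δ₀, hδ₀, fun x => (hobs₀ x).trans_eq ?_⟩
    refine intervalIntegral.integral_congr fun s hs => ?_
    rw [uIcc_of_le hT.le] at hs
    simp only [max_eq_left hs.1]
  obtain ⟨δ, hδ, hobsδ⟩ := hF.exists_observability_feedback hT C κ hobs'
  have hγ : √(1 - 2 * κ * δ) < 1 := by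
    rw [Real.sqrt_lt' one_pos]
    have : 0 < κ * δ := mul_pos hκ hδ
    linarith
  refine ⟨1, √(1 - 2 * κ * δ), zero_le_one, Real.sqrt_nonneg _, hγ, fun f y hf hy => ?_⟩
  have hyi : IntervalIntegrable y volume 0 T := by
    rw [intervalIntegrable_iff_integrableOn_Icc_of_le hT.le]
    exact hy.integrable one_le_two
  choose z hz hz0 using fun x => hF.exists_isForwardSolution (C := C) (κ := κ) hT.le hf hyi x
  choose w hw hw0 using fun x => hG.exists_isBackwardSolution (C := C) (κ := κ) hT.le hf hyi x
  refine ⟨z, fun x => ⟨hz x, hz0 x, fun v hv hv0 =>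
    hF.eqOn_forward hκ.le hv (hz x) (hv0.trans (hz0 x).symm)⟩, ?_⟩
  have hcontr : ContractingWith (Real.toNNReal √(1 - 2 * κ * δ)) fun x => w (z x T) T := by
    refine ⟨by rwa [Real.toNNReal_lt_one], LipschitzWith.of_dist_le_mul fun x x' => ?_⟩
    rw [Real.coe_toNNReal _ (Real.sqrt_nonneg _), dist_eq_norm, dist_eq_norm]
    have := hF.norm_round_trip_le hT.le hκ.le hobsδ (hz x) (hz x') (hw (z x T)) (hw (z x' T))
      (hw0 _) (hw0 _)
    rwa [hz0, hz0] at this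
  obtain ⟨xo, hxo, -⟩ := hcontr.exists_fixedPoint 0 (edist_ne_top _ _)
  have hxo : w (z xo T) T = xo := hxo
  refine ⟨xo, fun x hx => ?_, fun x₁ => ⟨?_, ?_⟩⟩
  · have hφ := (hz x).sub (hz xo)
    have horth := hF.integral_inner_eq_zero hT.le hκ (hz xo) (hw (z xo T)) (hw0 _)
      (hxo.trans (hz0 xo).symm) hφ
    have hpos := hobsδ _ hφ
    simp only [hz0] at hpos
    rw [BFN.outputCost_eq_add hT.le hy (hz xo).continuousOn (hz x).continuousOn horth]
    have : 0 < δ * ‖x - xo‖ ^ 2 := by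
      have := norm_pos_iff.2 (sub_ne_zero.2 hx)
      positivity
    linarith
  -- Runs are numbered from `1`, so the `j`-th sweep starts from the iterate `j - 1`; the truncated
  -- value at `j = 0` plays no role.
  · let x : ℕ → X := fun n => (fun x => w (z x T) T)^[n - 1] x₁
    refine ⟨fun j => z (x j), fun j => w (z (x j) T), ⟨fun j _ => hz _, fun j _ => hw _,
      fun j _ => hw0 _, fun j hj => ?_⟩, hz0 _⟩
    obtain ⟨n, rfl⟩ := Nat.exists_eq_add_of_le' hj
    simp only [x, hz0, Nat.add_sub_cancel, Function.iterate_succ_apply']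
  · intro zp zm hrun h1
    -- The run is compared with the one started at `xo`, which returns to `xo` after each round
    -- trip.
    have hstep : ∀ j, 1 ≤ j → ‖zm j T - xo‖ ≤ √(1 - 2 * κ * δ) * ‖zp j 0 - xo‖ := by
      intro j hj
      have := hF.norm_round_trip_le hT.le hκ.le hobsδ (hrun.forward j hj) (hz xo)
        (hrun.backward j hj) (hw (z xo T)) (hrun.backward_init j hj) (hw0 _)
      rwa [hxo, hz0] at this
    intro j hj
    rw [one_mul]
    induction j, hj using Nat.le_induction with
    | base => simpa [h1] using hstep 1 le_rfl
    | succ j hj ih =>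
      refine (hstep (j + 1) (by omega)).trans ?_
      rw [hrun.forward_init j hj, pow_succ', mul_assoc (√_)]
      exact mul_le_mul_of_nonneg_left ih (Real.sqrt_nonneg _)
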